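/- Let $n\ge n_1\ge 1$ and $k\ge 1$ be integers, let $X=(X_1,\dots,X_n)$ be a centered (possibly degenerate) Gaussian vector in $\mathbb{R}^n$, and let $X^{(1)},\dots,X^{(k)}$ be $k$ independent copies of $X$, defined on a common probability space. Let $\Gamma=(\Gamma_1,\dots,\Gamma_n)$ be the multivariate Gamma vector with parameter $k/2$ given by $$\Gamma_i=\frac12\sum_{m=1}^{k}\bigl(X_i^{(m)}\bigr)^2,\qquad 1\le i\le n.$$ Then $$\mathbb{P}\Bigl[\max_{1\le i\le n}\Gamma_i\le\tfrac12\Bigr]\ \ge\ \mathbb{P}\Bigl[\max_{1\le i\le n_1}\Gamma_i\le\tfrac12\Bigr]\;\mathbb{P}\Bigl[\max_{n_1<i\le n}\Gamma_i\le\tfrac12\Bigr],$$ where, if $n_1=n$, the condition over the empty index set holds trivially, so that the last probability equals $1$. -/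

import Mathlib

open MeasureTheory ProbabilityTheory

/-- The multivariate Gamma vector `Γ = (Γ_1, …, Γ_n)` of parameter `k / 2` built from `k` random
vectors `X^(1), …, X^(k)` in `ℝⁿ`: `Γ_i = (1/2) * ∑_m (X^(m)_i)^2`. -/
noncomputable def gammaVector {Ω : Type*} {k n : ℕ} (X : Fin k → Ω → (Fin n → ℝ))
    (i : Fin n) (ω : Ω) : ℝ :=
  (1 / 2 : ℝ) * ∑ m : Fin k, (X m ω i) ^ 2

/-- `X` is a centered Gaussian vector in `ℝⁿ` (possibly degenerate) under `P`. -/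
structure IsCenteredGaussianVector {Ω : Type*} [MeasurableSpace Ω] {n : ℕ}
    (X : Ω → (Fin n → ℝ)) (P : Measure Ω) : Prop where
  gaussian : HasGaussianLaw X P
  centered : ∀ i : Fin n, ∫ ω, X ω i ∂P = 0

/-- The event `max_{i ∈ J} Γ_i ≤ c`, i.e. `Γ_i ≤ c` for all `i ∈ J`
(the whole space when `J` is empty). -/
def maxLEEvent {Ω : Type*} {n : ℕ} (Γ : Fin n → Ω → ℝ) (J : Set (Fin n)) (c : ℝ) : Set Ω :=
  {ω | ∀ i ∈ J, Γ i ω ≤ c}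

/-! ### Determinants under damping of the cross-covariances -/

section Determinants

open Matrix

variable {ι : Type*} [Fintype ι] [DecidableEq ι]

/-! This is Royen's interpolation: multiply the covariances between the two blocks of indices by
`τ`. At `τ = 1` the given law appears, at `τ = 0` the blocks are independent, so it suffices that
the expectation of a suitable product is monotone in `τ`.

The Laplace transform of `Γ` is `det (1 + diag(l) C) ^ (-k/2)`. Expanding the determinant in
principal minors of `C`, its `τ`-derivative is a sum of terms: minus the derivative of a minor,
times `∏ i ∈ s, l i`, times `k/2` and the Laplace transform for `k + 2` copies. Each minor decreases
in `τ` (`antitoneOn_det_crossScale`), so the first factor is nonnegative.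

Densities, which a singular `C` would not provide, are avoided by testing against `∏ i, q (exp (-Γ
i))` with `q` a polynomial: only Laplace transforms at integer points occur, and there a factor `l
i` amounts to replacing `q` by `X * q'` (`hasDerivAt_interpolation`). For `q, q' ≥ 0` on `[0, 1]`
everything is nonnegative (`monotoneOn_interpolation`). Polynomials converging to a step function
then give the probabilities. -/

lemma Matrix.IsHermitian.det_smul_one_add_smul {A : Matrix ι ι ℝ} (hA : A.IsHermitian) (a b : ℝ) :
    (a • (1 : Matrix ι ι ℝ) + b • A).det = ∏ i, (a + b * hA.eigenvalues i) := by
  have h : a • (1 : Matrix ι ι ℝ) + b • A = Unitary.conjStarAlgAut ℝ _ hA.eigenvectorUnitary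
      (a • (1 : Matrix ι ι ℝ) + b • diagonal hA.eigenvalues) := by
    conv_lhs => rw [hA.spectral_theorem]
    simp only [map_add, map_smul, map_one]
    rfl
  have h2 : a • (1 : Matrix ι ι ℝ) + b • diagonal hA.eigenvalues =
      diagonal (fun i => a + b * hA.eigenvalues i) := by
    rw [← diagonal_one, ← diagonal_smul, ← diagonal_smul, diagonal_add]
    simp
  rw [h, h2, Unitary.conjStarAlgAut_apply, det_mul_comm, ← mul_assoc]
  simp

/-- Weighted AM-GM gives `x ^ b ≤ a + b * x` for each eigenvalue `x`, and the eigenvalues multiply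
to `1`. -/
lemma Matrix.PosSemidef.one_le_det_smul_one_add_smul {A : Matrix ι ι ℝ} (hA : A.PosSemidef)
    (hdet : A.det = 1) {a b : ℝ} (ha : 0 ≤ a) (hb : 0 ≤ b) (hab : a + b = 1) :
    1 ≤ (a • (1 : Matrix ι ι ℝ) + b • A).det := by
  rw [hA.isHermitian.det_smul_one_add_smul]
  have hev : ∏ i, hA.isHermitian.eigenvalues i = 1 := by
    rw [← hdet, hA.isHermitian.det_eq_prod_eigenvalues]; simp
  calc (1 : ℝ) = ∏ i, hA.isHermitian.eigenvalues i ^ b := by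
        rw [Real.finsetProd_rpow _ _ (fun i _ => hA.eigenvalues_nonneg i), hev, Real.one_rpow]
    _ ≤ _ := by
        refine Finset.prod_le_prod (fun i _ => Real.rpow_nonneg (hA.eigenvalues_nonneg i) _)
          fun i _ => ?_
        simpa using Real.geom_mean_le_arith_mean2_weighted ha hb zero_le_one
          (hA.eigenvalues_nonneg i) hab

open scoped MatrixOrder in
/-- On a segment joining two positive semidefinite matrices of equal determinant, the determinant
is at least the common value. -/
lemma Matrix.PosSemidef.det_le_det_smul_add_smul {M N : Matrix ι ι ℝ} (hM : M.PosSemidef)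
    (hN : N.PosSemidef) (hdet : N.det = M.det) {a b : ℝ} (ha : 0 ≤ a) (hb : 0 ≤ b)
    (hab : a + b = 1) : M.det ≤ (a • M + b • N).det := by
  by_cases h0 : M.det = 0
  · rw [h0]
    exact ((hM.smul ha).add (hN.smul hb)).det_nonneg
  -- With `M = Bᴴ * B`, conjugation by `B⁻¹` reduces to `M = 1` and a second matrix of determinant
  -- `1`.
  obtain ⟨B, hB⟩ := CStarAlgebra.nonneg_iff_eq_star_mul_self.mp hM.nonneg
  rw [star_eq_conjTranspose] at hB
  have hMB : M.det = B.det * B.det := by rw [hB, det_mul, det_conjTranspose]; simp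
  have hBu : IsUnit B.det := by
    rw [isUnit_iff_ne_zero]
    intro h
    exact h0 (by rw [hMB, h, zero_mul])
  have hR : ((B⁻¹)ᴴ * N * B⁻¹).PosSemidef := hN.conjTranspose_mul_mul_same _
  have hinv : (B⁻¹).det * B.det = 1 := by rw [← det_mul, nonsing_inv_mul _ hBu, det_one]
  have hRdet : ((B⁻¹)ᴴ * N * B⁻¹).det = 1 := by
    rw [det_mul, det_mul, det_conjTranspose, hdet, hMB]
    simp only [star_trivial]
    linear_combination ((B⁻¹).det * B.det + 1) * hinv
  have hBB : Bᴴ * (B⁻¹)ᴴ = 1 := by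
    rw [← conjTranspose_mul, nonsing_inv_mul _ hBu, conjTranspose_one]
  have key : a • M + b • N =
      Bᴴ * (a • (1 : Matrix ι ι ℝ) + b • ((B⁻¹)ᴴ * N * B⁻¹)) * B := by
    have h1 : Bᴴ * ((B⁻¹)ᴴ * N * B⁻¹) * B = N := by
      calc Bᴴ * ((B⁻¹)ᴴ * N * B⁻¹) * B = (Bᴴ * (B⁻¹)ᴴ) * N * (B⁻¹ * B) := by
            simp only [Matrix.mul_assoc]
        _ = N := by rw [hBB, nonsing_inv_mul _ hBu, Matrix.one_mul, Matrix.mul_one]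
    rw [Matrix.mul_add, Matrix.add_mul, Matrix.mul_smul, Matrix.mul_smul, Matrix.smul_mul,
      Matrix.smul_mul, h1, Matrix.mul_one, hB]
  have h1 := hR.one_le_det_smul_one_add_smul hRdet ha hb hab
  rw [key, det_mul, det_mul, det_conjTranspose, star_trivial, hMB]
  nlinarith [mul_self_nonneg B.det]

/-- Scale by `τ` the entries of `C` whose row and column are separated by the predicate `p`. -/
def crossScale {κ : Type*} (p : κ → Prop) [DecidablePred p] (τ : ℝ) (C : Matrix κ κ ℝ) :
    Matrix κ κ ℝ :=
  Matrix.of fun i j => (if p i ↔ p j then 1 else τ) * C i j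

section CrossScale

variable (p : ι → Prop) [DecidablePred p] (C : Matrix ι ι ℝ)

omit [Fintype ι] [DecidableEq ι] in
lemma crossScale_one : crossScale p 1 C = C := by
  ext i j; simp [crossScale]

omit [Fintype ι] [DecidableEq ι] in
lemma crossScale_mul (s t : ℝ) : crossScale p (s * t) C = crossScale p s (crossScale p t C) := by
  ext i j
  simp only [crossScale, of_apply]
  split_ifs <;> ring

/-- Conjugation by a diagonal sign matrix flips exactly the cross entries and preserves the
determinant. For `s ∈ [0, 1]` this is a convex combination, which yields both positivity and the
determinant bound. -/
lemma crossScale_eq_smul_add_smul (s : ℝ) :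
    crossScale p s C = ((1 + s) / 2) • C + ((1 - s) / 2) •
      (diagonal (fun i => if p i then 1 else -1) * C * diagonal (fun i => if p i then 1 else -1)) := by
  ext i j
  by_cases hi : p i <;> by_cases hj : p j <;>
    simp [crossScale, hi, hj] <;> ring

variable {C}

lemma Matrix.PosSemidef.sign_conj (hC : C.PosSemidef) :
    (diagonal (fun i => if p i then (1 : ℝ) else -1) * C *
      diagonal (fun i => if p i then (1 : ℝ) else -1)).PosSemidef := by
  simpa using hC.mul_mul_conjTranspose_same (diagonal (fun i => if p i then (1 : ℝ) else -1))

omit [Fintype ι] in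
lemma Matrix.PosSemidef.crossScale [Finite ι] (hC : C.PosSemidef) {s : ℝ} (hs : s ∈ Set.Icc 0 1) :
    (crossScale p s C).PosSemidef := by
  have := Fintype.ofFinite ι
  rw [crossScale_eq_smul_add_smul]
  exact (hC.smul (by linarith [hs.1])).add ((hC.sign_conj p).smul (by linarith [hs.2]))

lemma Matrix.PosSemidef.det_le_det_crossScale (hC : C.PosSemidef) {s : ℝ}
    (hs : s ∈ Set.Icc 0 1) : C.det ≤ (_root_.crossScale p s C).det := by
  rw [crossScale_eq_smul_add_smul]
  refine hC.det_le_det_smul_add_smul (hC.sign_conj p) ?_ (by linarith [hs.1]) (by linarith [hs.2])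
    (by ring)
  have : (∏ i, if p i then (1 : ℝ) else -1) * (∏ i, if p i then (1 : ℝ) else -1) = 1 := by
    rw [← Finset.prod_mul_distrib]
    exact Finset.prod_eq_one fun i _ => by split_ifs <;> norm_num
  rw [det_mul, det_mul, det_diagonal]
  linear_combination C.det * this

/-- Scalings compose multiplicatively, so comparing `s ≤ t` is the bound against the unscaled
matrix, applied to `crossScale p t C` with factor `s / t`. -/
lemma Matrix.PosSemidef.antitoneOn_det_crossScale (hC : C.PosSemidef) :
    AntitoneOn (fun τ => (_root_.crossScale p τ C).det) (Set.Icc 0 1) := by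
  intro s hs t ht hst
  obtain rfl | h0 := ht.1.eq_or_lt
  · rw [le_antisymm hst hs.1]
  have := (hC.crossScale p ht).det_le_det_crossScale p (s := s / t)
    ⟨div_nonneg hs.1 h0.le, (div_le_one h0).2 hst⟩
  rwa [← crossScale_mul, div_mul_cancel₀ _ h0.ne'] at this

variable (C)

lemma differentiable_det_crossScale : Differentiable ℝ fun τ => (crossScale p τ C).det := by
  simp only [det_apply, crossScale, of_apply]
  refine Differentiable.fun_sum fun σ _ => Differentiable.const_smul ?_ _
  refine Differentiable.fun_finsetProd fun i _ => Differentiable.mul_const ?_ _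
  have h : Differentiable ℝ fun τ : ℝ => if (p (σ i) ↔ p i) then 1 else τ := by
    split_ifs <;> fun_prop
  exact h

variable {C}

lemma Matrix.PosSemidef.deriv_det_crossScale_nonpos (hC : C.PosSemidef) {τ : ℝ}
    (hτ : τ ∈ Set.Ioo 0 1) : deriv (fun τ => (_root_.crossScale p τ C).det) τ ≤ 0 := by
  have h := (hC.antitoneOn_det_crossScale p).derivWithin_nonpos (x := τ)
  rwa [derivWithin_of_mem_nhds (Icc_mem_nhds hτ.1 hτ.2)] at h

end CrossScale

/-- Expansion of `det (1 + diag(l) C)` in principal minors of `C`. -/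
lemma Matrix.det_one_add_diagonal_mul (C : Matrix ι ι ℝ) (l : ι → ℝ) :
    (1 + diagonal l * C).det =
      ∑ s : Finset ι, (∏ i ∈ s, l i) * (C.submatrix (Subtype.val : s → ι) Subtype.val).det := by
  have h1 : (1 + diagonal l * C).det =
      detRowAlternating ((fun i => l i • C.row i) + (1 : Matrix ι ι ℝ).row) := by
    rw [add_comm]
    congr 1
    ext i j
    change _ = l i * C i j + (1 : Matrix ι ι ℝ) i j
    simp
  rw [h1, AlternatingMap.map_add_univ]
  refine Finset.sum_congr rfl fun s _ => ?_
  have h2 : s.piecewise (fun i => l i • C.row i) (1 : Matrix ι ι ℝ).row =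
      fun i => (if i ∈ s then l i else 1) • s.piecewise C.row (1 : Matrix ι ι ℝ).row i := by
    funext i
    by_cases hi : i ∈ s <;> simp [hi]
  rw [h2, AlternatingMap.map_smul_univ, ← det_piecewise_one_eq_submatrix_det, Finset.prod_ite_mem,
    Finset.univ_inter]
  rfl

lemma Matrix.PosSemidef.one_le_det_one_add_diagonal_mul {C : Matrix ι ι ℝ} (hC : C.PosSemidef)
    {l : ι → ℝ} (hl : ∀ i, 0 ≤ l i) : 1 ≤ (1 + diagonal l * C).det := by
  rw [det_one_add_diagonal_mul, ← Finset.add_sum_erase _ _ (Finset.mem_univ ∅)]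
  have : 0 ≤ ∑ s ∈ Finset.univ.erase (∅ : Finset ι),
      (∏ i ∈ s, l i) * (C.submatrix (Subtype.val : s → ι) Subtype.val).det :=
    Finset.sum_nonneg fun s _ =>
      mul_nonneg (Finset.prod_nonneg fun i _ => hl i) (hC.submatrix _).det_nonneg
  simpa using this

/-- Each factor keeps the full `C` and zeroes weights instead of passing to a block, so it is
directly a Laplace transform of the original vector. -/
lemma det_one_add_diagonal_mul_crossScale_zero (p : ι → Prop) [DecidablePred p]
    (C : Matrix ι ι ℝ) (l : ι → ℝ) :
    (1 + diagonal l * crossScale p 0 C).det =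
      (1 + diagonal (fun i => if p i then l i else 0) * C).det *
        (1 + diagonal (fun i => if p i then 0 else l i) * C).det := by
  set P : Matrix ι ι ℝ := diagonal fun i => if p i then 1 else 0
  set Q : Matrix ι ι ℝ := diagonal fun i => if p i then 0 else 1
  set A : Matrix ι ι ℝ := diagonal (fun i => if p i then l i else 0)
  set B : Matrix ι ι ℝ := diagonal (fun i => if p i then 0 else l i)
  have hPA : P * A = A := by
    simp only [P, A, diagonal_mul_diagonal]; congr 1; ext i; split_ifs <;> simp
  have hQB : Q * B = B := by
    simp only [Q, B, diagonal_mul_diagonal]; congr 1; ext i; split_ifs <;> simp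
  have hPB : P * B = 0 := by
    simp only [P, B, diagonal_mul_diagonal]; rw [← diagonal_zero]; congr 1; ext i; split_ifs <;> simp
  have h1 : (1 + A * C).det = (1 + A * C * P).det := by
    rw [det_one_add_mul_comm (A * C) P, ← Matrix.mul_assoc, hPA]
  have h2 : (1 + B * C).det = (1 + B * C * Q).det := by
    rw [det_one_add_mul_comm (B * C) Q, ← Matrix.mul_assoc, hQB]
  rw [h1, h2, ← det_mul]
  congr 1
  have h3 : A * C * P * (B * C * Q) = 0 := by
    calc A * C * P * (B * C * Q) = A * C * (P * B) * C * Q := by simp only [Matrix.mul_assoc]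
      _ = 0 := by rw [hPB]; simp
  have h4 : diagonal l * crossScale p 0 C = A * C * P + B * C * Q := by
    ext i j
    by_cases hi : p i <;> by_cases hj : p j <;> simp [crossScale, A, B, P, Q, hi, hj]
  rw [Matrix.add_mul, Matrix.mul_add, Matrix.mul_add, h3, h4]
  simp only [Matrix.one_mul, Matrix.mul_one, add_zero]
  abel

end Determinants

/-! ### Gaussian integrals of quadratic exponentials -/

section Laplace

open Matrix WithLp
open scoped RealInnerProductSpace MatrixOrder

lemma integral_exp_neg_mul_sq_gaussianReal {d : ℝ} (hd : 0 ≤ d) :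
    ∫ x, Real.exp (-(d * x ^ 2) / 2) ∂gaussianReal 0 1 = (√(1 + d))⁻¹ := by
  have h1 : ∀ x : ℝ, gaussianPDFReal 0 1 x • Real.exp (-(d * x ^ 2) / 2) =
      (√(2 * Real.pi))⁻¹ * Real.exp (-((1 + d) / 2) * x ^ 2) := by
    intro x
    simp only [gaussianPDFReal, NNReal.coe_one, mul_one, sub_zero, smul_eq_mul]
    rw [mul_assoc, ← Real.exp_add]
    congr 2
    ring
  rw [integral_gaussianReal_eq_integral_smul one_ne_zero]
  simp_rw [h1]
  rw [integral_const_mul, integral_gaussian, ← Real.sqrt_inv, ← Real.sqrt_mul (by positivity),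
    ← Real.sqrt_inv]
  congr 1
  field_simp

variable {ι : Type*} [Fintype ι] [DecidableEq ι]

lemma Matrix.IsHermitian.inner_toEuclideanCLM_sum_eigenvectorBasis {A : Matrix ι ι ℝ}
    (hA : A.IsHermitian) (y : ι → ℝ) :
    ⟪∑ i, y i • hA.eigenvectorBasis i,
      toEuclideanCLM (𝕜 := ℝ) A (∑ i, y i • hA.eigenvectorBasis i)⟫ =
      ∑ i, hA.eigenvalues i * y i ^ 2 := by
  have h : ∀ i, toEuclideanCLM (𝕜 := ℝ) A (hA.eigenvectorBasis i) =
      hA.eigenvalues i • hA.eigenvectorBasis i := by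
    intro i
    ext j
    simpa using congrFun (hA.mulVec_eigenvectorBasis i) j
  simp_rw [map_sum, map_smul, h, smul_smul]
  rw [hA.eigenvectorBasis.orthonormal.inner_sum]
  exact Finset.sum_congr rfl fun i _ => by simp; ring

/-- By rotation invariance, the coordinates in an eigenbasis of `A` are independent standard
normals, and the integral factors. -/
lemma Matrix.PosSemidef.integral_exp_stdGaussian {A : Matrix ι ι ℝ} (hA : A.PosSemidef) :
    ∫ x, Real.exp (-⟪x, toEuclideanCLM (𝕜 := ℝ) A x⟫ / 2) ∂stdGaussian (EuclideanSpace ℝ ι) =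
      (√(1 + A).det)⁻¹ := by
  rw [stdGaussian_eq_map_pi_orthonormalBasis hA.isHermitian.eigenvectorBasis,
    integral_map (Measurable.aemeasurable (by fun_prop)) (by fun_prop)]
  simp_rw [hA.isHermitian.inner_toEuclideanCLM_sum_eigenvectorBasis, ← Finset.sum_neg_distrib,
    Finset.sum_div, Real.exp_sum]
  rw [integral_fintype_prod_eq_prod
    (f := fun i x => Real.exp (-(hA.isHermitian.eigenvalues i * x ^ 2) / 2))]
  simp_rw [fun i => integral_exp_neg_mul_sq_gaussianReal (hA.eigenvalues_nonneg i)]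
  have := hA.isHermitian.det_smul_one_add_smul 1 1
  simp only [one_smul, one_mul] at this
  rw [this, Finset.prod_inv_distrib, Real.sqrt_prod]
  exact fun i _ => by linarith [hA.eigenvalues_nonneg i]

/-- The Laplace transform of the squared coordinates of a centered Gaussian vector. -/
lemma Matrix.PosSemidef.integral_exp_multivariateGaussian {C : Matrix ι ι ℝ} (hC : C.PosSemidef)
    {l : ι → ℝ} (hl : ∀ i, 0 ≤ l i) :
    ∫ x, Real.exp (-(∑ i, l i * x i ^ 2) / 2) ∂multivariateGaussian 0 C =
      (√(1 + diagonal l * C).det)⁻¹ := by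
  -- The vector is `S` applied to a standard Gaussian, so the quadratic form becomes `S * diagonal l
  -- * S`; no inverse of `C` is needed.
  set S := CFC.sqrt C
  have hSS : S * S = C := CFC.sqrt_mul_sqrt_self C hC.nonneg
  have hS : Sᴴ = S := (CFC.sqrt_nonneg C).posSemidef.isHermitian
  have hA : (S * diagonal l * S).PosSemidef := by
    have := (PosSemidef.diagonal (show 0 ≤ l from hl)).conjTranspose_mul_mul_same S
    rwa [hS] at this
  have hdet : (1 + diagonal l * C).det = (1 + S * diagonal l * S).det := by
    rw [Matrix.mul_assoc S, det_one_add_mul_comm S, Matrix.mul_assoc, hSS]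
  rw [hdet, ← hA.integral_exp_stdGaussian, multivariateGaussian,
    integral_map (by fun_prop) (by fun_prop)]
  congr 1
  ext x
  congr 2
  rw [inner_toEuclideanCLM]
  simp only [zero_add, ← mulVec_mulVec]
  rw [dotProduct_mulVec, ← mulVec_transpose]
  have hS' : Sᵀ = S := by simpa using hS
  rw [hS']
  simp only [dotProduct, mulVec_diagonal, neg_inj]
  exact Finset.sum_congr rfl fun i _ => by
    change l i * (S *ᵥ ofLp x) i ^ 2 = _
    ring

end Laplace

/-! ### Laplace transform of the Gamma vector -/

section GammaLaplace

open Matrix WithLp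

variable {Ω : Type*} [MeasurableSpace Ω] {P : Measure Ω} {k n : ℕ}
  {X : Fin k → Ω → (Fin n → ℝ)}

omit [MeasurableSpace Ω] in
lemma gammaVector_nonneg (i : Fin n) (ω : Ω) : 0 ≤ gammaVector X i ω :=
  mul_nonneg (by norm_num) (Finset.sum_nonneg fun _ _ => sq_nonneg _)

lemma aemeasurable_gammaVector (hX : ∀ m, AEMeasurable (X m) P) (i : Fin n) :
    AEMeasurable (gammaVector X i) P := by
  unfold gammaVector
  refine AEMeasurable.const_mul (Finset.aemeasurable_fun_sum _ fun m _ => ?_) _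
  exact ((measurable_pi_apply i).comp_aemeasurable (hX m)).pow_const 2

/-- The Laplace transform of the multivariate Gamma vector. -/
lemma integral_exp_neg_sum_mul_gammaVector {C : Matrix (Fin n) (Fin n) ℝ} (hC : C.PosSemidef)
    (hX : ∀ m, AEMeasurable (X m) P)
    (hlaw : ∀ m, HasLaw (fun ω => toLp 2 (X m ω)) (multivariateGaussian 0 C) P)
    (hind : iIndepFun X P) {l : Fin n → ℝ} (hl : ∀ i, 0 ≤ l i) :
    ∫ ω, Real.exp (-∑ i, l i * gammaVector X i ω) ∂P =
      (√(1 + diagonal l * C).det)⁻¹ ^ k := by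
  have h1 : ∀ ω, Real.exp (-∑ i, l i * gammaVector X i ω) =
      ∏ m, Real.exp (-(∑ i, l i * X m ω i ^ 2) / 2) := by
    intro ω
    rw [← Real.exp_sum, ← Finset.sum_div, Finset.sum_neg_distrib, Finset.sum_comm, neg_div,
      Finset.sum_div]
    congr 2
    refine Finset.sum_congr rfl fun i _ => ?_
    rw [gammaVector, ← Finset.mul_sum]
    ring
  simp_rw [h1]
  rw [hind.integral_fun_prod_comp (f := fun m x => Real.exp (-(∑ i, l i * x i ^ 2) / 2)) hX
    (fun m => Measurable.aestronglyMeasurable (by fun_prop))]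
  have h2 : ∀ m, ∫ ω, Real.exp (-(∑ i, l i * X m ω i ^ 2) / 2) ∂P =
      (√(1 + diagonal l * C).det)⁻¹ := by
    intro m
    rw [← hC.integral_exp_multivariateGaussian hl, ← (hlaw m).map_eq,
      integral_map (hlaw m).aemeasurable (by fun_prop)]
  simp [h2]

/-- Supplies the `k + 2` copies with scaled covariance that turn the derivative of the interpolation
into an expectation. -/
lemma exists_iIndepFun_hasLaw_multivariateGaussian (C : Matrix (Fin n) (Fin n) ℝ) (k : ℕ) :
    ∃ (P : Measure (Fin k → EuclideanSpace ℝ (Fin n))) (_ : IsProbabilityMeasure P)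
      (X : Fin k → (Fin k → EuclideanSpace ℝ (Fin n)) → (Fin n → ℝ)),
      (∀ m, AEMeasurable (X m) P) ∧
      (∀ m, HasLaw (fun ω => toLp 2 (X m ω)) (multivariateGaussian 0 C) P) ∧ iIndepFun X P := by
  refine ⟨Measure.pi fun _ => multivariateGaussian 0 C, inferInstance, fun m ω => ofLp (ω m),
    fun m => Measurable.aemeasurable (by fun_prop), fun m => ?_, ?_⟩
  · exact (measurePreserving_eval (fun _ : Fin k => multivariateGaussian 0 C) m).hasLaw
  · exact iIndepFun_pi (X := fun _ x => ofLp x) fun m => Measurable.aemeasurable (by fun_prop)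

/-- A centered Gaussian vector has law `multivariateGaussian 0 C` for its covariance matrix `C`. -/
lemma IsCenteredGaussianVector.exists_hasLaw [IsProbabilityMeasure P] {Y : Ω → (Fin n → ℝ)}
    (hY : IsCenteredGaussianVector Y P) :
    ∃ C : Matrix (Fin n) (Fin n) ℝ, C.PosSemidef ∧
      HasLaw (fun ω => toLp 2 (Y ω)) (multivariateGaussian 0 C) P := by
  have hG : HasGaussianLaw (fun ω => toLp 2 (Y ω)) P := HasGaussianLaw.toLp_pi 2 hY.gaussian
  have hGm := hG.isGaussian_map
  have hmem : ∀ i, MemLp (fun ω => Y ω i) 2 P := fun i =>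
    HasGaussianLaw.memLp_two (HasGaussianLaw.eval (X := fun i ω => Y ω i) hY.gaussian i)
  set C : Matrix (Fin n) (Fin n) ℝ := of fun i j => cov[fun ω => Y ω i, fun ω => Y ω j; P] with hCdef
  have hbil : ∀ x y : EuclideanSpace ℝ (Fin n),
      covarianceBilin (P.map fun ω => toLp 2 (Y ω)) x y = x ⬝ᵥ C *ᵥ y := by
    intro x y
    rw [covarianceBilin_apply_pi (X := fun i ω => Y ω i) hmem]
    simp only [dotProduct, mulVec, Finset.mul_sum, hCdef, of_apply]
    exact Finset.sum_congr rfl fun i _ => Finset.sum_congr rfl fun j _ => by ring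
  have hC : C.PosSemidef := by
    refine PosSemidef.of_dotProduct_mulVec_nonneg ?_ fun x => ?_
    · ext i j
      simp [hCdef, covariance_comm]
    · have := covarianceBilin_self_nonneg (μ := P.map fun ω => toLp 2 (Y ω)) (toLp 2 x)
      rw [hbil] at this
      simpa using this
  refine ⟨C, hC, hG.aemeasurable, IsGaussian.ext ?_ ?_⟩
  · rw [integral_id_multivariateGaussian', integral_map hG.aemeasurable (by fun_prop)]
    simp only [id]
    ext i
    have := (EuclideanSpace.proj (𝕜 := ℝ) i).integral_comp_comm hG.integrable
    exact this.symm.trans (hY.centered i)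
  · ext x y
    rw [hbil, covarianceBilin_multivariateGaussian hC]

end GammaLaplace

/-! ### Expectations of polynomials in `exp (-Γ i)` -/

section PolynomialMoments

open Polynomial

variable {Ω : Type*} [MeasurableSpace Ω] {P : Measure Ω} [IsProbabilityMeasure P] {n : ℕ}

lemma integrable_exp_neg_sum_mul {Γ : Fin n → Ω → ℝ} (hΓ : ∀ i, AEMeasurable (Γ i) P)
    (hnn : ∀ i ω, 0 ≤ Γ i ω) {l : Fin n → ℝ} (hl : ∀ i, 0 ≤ l i) :
    Integrable (fun ω => Real.exp (-∑ i, l i * Γ i ω)) P := by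
  refine Integrable.of_bound (C := 1) ?_ (ae_of_all _ fun ω => ?_)
  · refine (Real.measurable_exp.comp_aemeasurable ?_).aestronglyMeasurable
    exact (Finset.aemeasurable_fun_sum _ fun i _ => (hΓ i).const_mul _).neg
  · rw [Real.norm_eq_abs, Real.abs_exp, Real.exp_le_one_iff, neg_nonpos]
    exact Finset.sum_nonneg fun i _ => mul_nonneg (hl i) (hnn i ω)

lemma integral_prod_eval_exp_neg {Γ : Fin n → Ω → ℝ} (hΓ : ∀ i, AEMeasurable (Γ i) P)
    (hnn : ∀ i ω, 0 ≤ Γ i ω) {N : ℕ} {f : Fin n → ℝ[X]} (hf : ∀ i, (f i).natDegree < N) :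
    ∫ ω, ∏ i, (f i).eval (Real.exp (-Γ i ω)) ∂P =
      ∑ m ∈ Fintype.piFinset fun _ : Fin n => Finset.range N,
        (∏ i, (f i).coeff (m i)) * ∫ ω, Real.exp (-∑ i, (m i : ℝ) * Γ i ω) ∂P := by
  have h1 : ∀ ω, ∏ i, (f i).eval (Real.exp (-Γ i ω)) =
      ∑ m ∈ Fintype.piFinset fun _ : Fin n => Finset.range N,
        (∏ i, (f i).coeff (m i)) * Real.exp (-∑ i, (m i : ℝ) * Γ i ω) := by
    intro ω
    simp_rw [fun i => eval_eq_sum_range' (hf i)]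
    rw [Finset.prod_univ_sum]
    refine Finset.sum_congr rfl fun m _ => ?_
    rw [Finset.prod_mul_distrib, ← Finset.sum_neg_distrib, Real.exp_sum]
    congr 1
    refine Finset.prod_congr rfl fun i _ => ?_
    rw [← Real.exp_nat_mul]
    congr 1
    ring
  simp_rw [h1]
  rw [integral_finsetSum]
  · simp_rw [integral_const_mul]
  · exact fun m _ => (integrable_exp_neg_sum_mul hΓ hnn fun i => Nat.cast_nonneg _).const_mul _

end PolynomialMoments

/-! ### Monotone interpolation between independent and given blocks -/

section Interpolation

open Polynomial Matrix WithLp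

variable {n : ℕ}

/-- The expectation of `∏ i, q (exp (-Γ i))` for the Gamma vector of parameter `k / 2` built from
the covariance matrix `crossScale p τ C`. -/
noncomputable def interpolation (p : Fin n → Prop) [DecidablePred p]
    (C : Matrix (Fin n) (Fin n) ℝ) (q : ℝ[X]) (k : ℕ) (τ : ℝ) : ℝ :=
  ∑ m ∈ Fintype.piFinset fun _ : Fin n => Finset.range (q.natDegree + 1),
    (∏ i, q.coeff (m i)) *
      (√(1 + diagonal (fun i => (m i : ℝ)) * crossScale p τ C).det)⁻¹ ^ k

/-- Written with exponent `k + 2` so that the remaining factor is again a Laplace transform, now of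
a Gamma vector with two more copies. -/
lemma HasDerivAt.inv_sqrt_pow {D : ℝ → ℝ} {D' τ : ℝ} (hD : HasDerivAt D D' τ) (h0 : 0 < D τ)
    (k : ℕ) :
    HasDerivAt (fun τ => (√(D τ))⁻¹ ^ k) (-((k : ℝ) / 2 * D' * (√(D τ))⁻¹ ^ (k + 2))) τ := by
  have hs : √(D τ) ≠ 0 := (Real.sqrt_pos.2 h0).ne'
  refine (((hD.sqrt h0.ne').fun_inv hs).fun_pow k).congr_deriv ?_
  rcases k with _ | k
  · simp
  · rw [Nat.add_sub_cancel, show (√(D τ))⁻¹ ^ (k + 1 + 2) = (√(D τ))⁻¹ ^ k * (√(D τ))⁻¹ ^ 3 by ring,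
      inv_pow _ 3]
    generalize (√(D τ))⁻¹ ^ k = w
    field_simp

variable {p : Fin n → Prop} [DecidablePred p] {C : Matrix (Fin n) (Fin n) ℝ}

lemma hasDerivAt_det_one_add_diagonal_mul_crossScale (l : Fin n → ℝ) (τ : ℝ) :
    HasDerivAt (fun τ => (1 + diagonal l * crossScale p τ C).det)
      (∑ s : Finset (Fin n), (∏ i ∈ s, l i) * deriv (fun τ =>
        (crossScale (fun i : s => p i) τ (C.submatrix Subtype.val Subtype.val)).det) τ) τ := by
  simp_rw [det_one_add_diagonal_mul]
  refine HasDerivAt.fun_sum fun s _ => HasDerivAt.const_mul _ ?_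
  -- A principal submatrix of `crossScale p τ C` is, by definition, the scaling of the submatrix of
  -- `C`.
  exact (differentiable_det_crossScale (fun i : s => p i)
    (C.submatrix Subtype.val Subtype.val) τ).hasDerivAt

/-- The minor expansion contributes `∏ i ∈ s, m i`; multiplying the coefficient of `X ^ m` by `m` is
the operator `X * d/dX`. -/
lemma hasDerivAt_interpolation (hC : C.PosSemidef) (q : ℝ[X]) (k : ℕ) {τ : ℝ}
    (hτ : τ ∈ Set.Icc 0 1) :
    HasDerivAt (interpolation p C q k)
      ((k : ℝ) / 2 * ∑ s : Finset (Fin n),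
        -deriv (fun τ =>
          (crossScale (fun i : s => p i) τ (C.submatrix Subtype.val Subtype.val)).det) τ *
        ∑ m ∈ Fintype.piFinset fun _ : Fin n => Finset.range (q.natDegree + 1),
          (∏ i, (if i ∈ s then X * derivative q else q).coeff (m i)) *
            (√(1 + diagonal (fun i => (m i : ℝ)) * crossScale p τ C).det)⁻¹ ^ (k + 2)) τ := by
  have hpos : ∀ m : Fin n → ℕ, 0 < (1 + diagonal (fun i => (m i : ℝ)) * crossScale p τ C).det :=
    fun m => zero_lt_one.trans_le
      ((hC.crossScale p hτ).one_le_det_one_add_diagonal_mul fun i => Nat.cast_nonneg _)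
  have hcoeff : ∀ (s : Finset (Fin n)) (m : Fin n → ℕ),
      ∏ i, (if i ∈ s then X * derivative q else q).coeff (m i) =
        (∏ i ∈ s, (m i : ℝ)) * ∏ i, q.coeff (m i) := by
    intro s m
    have h1 : ∀ i, (if i ∈ s then X * derivative q else q).coeff (m i) =
        (if i ∈ s then (m i : ℝ) else 1) * q.coeff (m i) := by
      intro i
      split_ifs
      · rcases m i with _ | j
        · simp
        · rw [coeff_X_mul, coeff_derivative]; push_cast; ring
      · rw [one_mul]
    simp_rw [h1]
    rw [Finset.prod_mul_distrib, Finset.prod_ite_mem, Finset.univ_inter]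
  have hterm := fun m : Fin n → ℕ => ((hasDerivAt_det_one_add_diagonal_mul_crossScale (p := p)
    (C := C) (fun i => (m i : ℝ)) τ).inv_sqrt_pow (hpos m) k).const_mul (∏ i, q.coeff (m i))
  have hsum := HasDerivAt.fun_sum (u := Fintype.piFinset fun _ : Fin n =>
    Finset.range (q.natDegree + 1)) fun m _ => hterm m
  change HasDerivAt (fun τ => interpolation p C q k τ) _ τ
  unfold interpolation
  refine hsum.congr_deriv ?_
  simp_rw [hcoeff, Finset.mul_sum]
  rw [Finset.sum_comm]
  refine Finset.sum_congr rfl fun m _ => ?_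
  rw [Finset.sum_mul, ← Finset.sum_neg_distrib, Finset.mul_sum]
  exact Finset.sum_congr rfl fun s _ => by ring

lemma monotoneOn_interpolation (hC : C.PosSemidef) {q : ℝ[X]} (k : ℕ)
    (hq : ∀ u ∈ Set.Icc (0 : ℝ) 1, 0 ≤ q.eval u)
    (hq' : ∀ u ∈ Set.Icc (0 : ℝ) 1, 0 ≤ (derivative q).eval u) :
    MonotoneOn (interpolation p C q k) (Set.Icc 0 1) := by
  refine monotoneOn_of_deriv_nonneg (convex_Icc 0 1)
    (fun τ hτ => (hasDerivAt_interpolation hC q k hτ).continuousAt.continuousWithinAt)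
    (fun τ hτ => (hasDerivAt_interpolation hC q k
      (interior_subset hτ)).differentiableAt.differentiableWithinAt) fun τ hτ => ?_
  have hτ' : τ ∈ Set.Icc (0 : ℝ) 1 := interior_subset hτ
  rw [interior_Icc] at hτ
  rw [(hasDerivAt_interpolation hC q k hτ').deriv]
  refine mul_nonneg (by positivity) (Finset.sum_nonneg fun s _ => mul_nonneg ?_ ?_)
  · exact neg_nonneg.2 ((hC.submatrix _).deriv_det_crossScale_nonpos _ hτ)
  have hCτ := hC.crossScale p hτ'
  -- The inner sum is an expectation over `k + 2` copies of a product of the nonnegative quantities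
  -- `q u` and `u * q' u`, with `u ∈ [0, 1]`.
  obtain ⟨P, hP, X, hX, hlaw, hind⟩ :=
    exists_iIndepFun_hasLaw_multivariateGaussian (crossScale p τ C) (k + 2)
  have hdeg : ∀ i, (if i ∈ s then Polynomial.X * derivative q else q).natDegree <
      q.natDegree + 1 := by
    intro i
    split_ifs
    -- For constant `q` the bound `1 + (natDegree - 1)` truncates to `1`, which is too large; there
    -- the product is zero.
    · rcases Nat.eq_zero_or_pos q.natDegree with h | h
      · rw [natDegree_eq_zero.1 h |>.choose_spec.symm]; simp
      · have h1 := natDegree_mul_le (p := (Polynomial.X : ℝ[X])) (q := derivative q)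
        have h2 := natDegree_derivative_le q
        rw [natDegree_X] at h1
        omega
    · exact Nat.lt_succ_self _
  have key := integral_prod_eval_exp_neg (aemeasurable_gammaVector hX) gammaVector_nonneg hdeg
  simp_rw [fun m : Fin n → ℕ => integral_exp_neg_sum_mul_gammaVector hCτ hX hlaw hind
    (l := fun i => (m i : ℝ)) fun i => Nat.cast_nonneg _] at key
  rw [← key]
  refine integral_nonneg fun ω => Finset.prod_nonneg fun i _ => ?_
  have hu : Real.exp (-gammaVector X i ω) ∈ Set.Icc (0 : ℝ) 1 :=
    ⟨(Real.exp_pos _).le, Real.exp_le_one_iff.2 (neg_nonpos.2 (gammaVector_nonneg i ω))⟩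
  split_ifs
  · rw [eval_mul, eval_X]
    exact mul_nonneg hu.1 (hq' _ hu)
  · exact hq _ hu

variable {Ω : Type*} [MeasurableSpace Ω] {P : Measure Ω} [IsProbabilityMeasure P] {k : ℕ}
  {Y : Fin k → Ω → (Fin n → ℝ)}

lemma interpolation_one (hC : C.PosSemidef) (hY : ∀ m, AEMeasurable (Y m) P)
    (hlaw : ∀ m, HasLaw (fun ω => toLp 2 (Y m ω)) (multivariateGaussian 0 C) P)
    (hind : iIndepFun Y P) (q : ℝ[X]) :
    interpolation p C q k 1 = ∫ ω, ∏ i, q.eval (Real.exp (-gammaVector Y i ω)) ∂P := by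
  rw [integral_prod_eval_exp_neg (f := fun _ => q) (aemeasurable_gammaVector hY)
    gammaVector_nonneg fun _ => Nat.lt_succ_self _]
  refine Finset.sum_congr rfl fun m _ => ?_
  rw [integral_exp_neg_sum_mul_gammaVector hC hY hlaw hind fun i => Nat.cast_nonneg _,
    crossScale_one]

lemma interpolation_zero (hC : C.PosSemidef) (hY : ∀ m, AEMeasurable (Y m) P)
    (hlaw : ∀ m, HasLaw (fun ω => toLp 2 (Y m ω)) (multivariateGaussian 0 C) P)
    (hind : iIndepFun Y P) (q : ℝ[X]) :
    interpolation p C q k 0 =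
      (∫ ω, ∏ i with p i, q.eval (Real.exp (-gammaVector Y i ω)) ∂P) *
        ∫ ω, ∏ i with ¬p i, q.eval (Real.exp (-gammaVector Y i ω)) ∂P := by
  -- The two blocks are read off independent copies of the sample space; matching Laplace transforms
  -- at integer points is all that is required.
  set Γ : Fin n → Ω × Ω → ℝ := fun i ω => if p i then gammaVector Y i ω.1 else gammaVector Y i ω.2
  have hΓ : ∀ i, AEMeasurable (Γ i) (P.prod P) := by
    intro i
    by_cases hi : p i
    · simpa only [Γ, hi, if_true] using (aemeasurable_gammaVector hY i).comp_fst
    · simpa only [Γ, hi, if_false] using (aemeasurable_gammaVector hY i).comp_snd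
  have hnn : ∀ i ω, 0 ≤ Γ i ω := by
    intro i ω
    simp only [Γ]
    split_ifs <;> exact gammaVector_nonneg _ _
  have key := integral_prod_eval_exp_neg (f := fun _ => q) hΓ hnn fun _ => Nat.lt_succ_self _
  have hprod : ∀ ω : Ω × Ω, ∏ i, q.eval (Real.exp (-Γ i ω)) =
      (∏ i with p i, q.eval (Real.exp (-gammaVector Y i ω.1))) *
        ∏ i with ¬p i, q.eval (Real.exp (-gammaVector Y i ω.2)) := by
    intro ω
    rw [← Finset.prod_filter_mul_prod_filter_not _ p]
    congr 1 <;> refine Finset.prod_congr rfl fun i hi => ?_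
    · simp [Γ, (Finset.mem_filter.1 hi).2]
    · simp [Γ, (Finset.mem_filter.1 hi).2]
  simp_rw [hprod] at key
  rw [integral_prod_mul (fun ω => ∏ i with p i, q.eval (Real.exp (-gammaVector Y i ω)))
    (fun ω => ∏ i with ¬p i, q.eval (Real.exp (-gammaVector Y i ω)))] at key
  rw [key]
  refine Finset.sum_congr rfl fun m _ => ?_
  congr 1
  have hexp : ∀ ω : Ω × Ω, Real.exp (-∑ i, (m i : ℝ) * Γ i ω) =
      Real.exp (-∑ i, (if p i then (m i : ℝ) else 0) * gammaVector Y i ω.1) *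
        Real.exp (-∑ i, (if p i then 0 else (m i : ℝ)) * gammaVector Y i ω.2) := by
    intro ω
    rw [← Real.exp_add, ← neg_add, ← Finset.sum_add_distrib]
    congr 2
    refine Finset.sum_congr rfl fun i _ => ?_
    by_cases hi : p i <;> simp [Γ, hi]
  simp_rw [hexp]
  rw [integral_prod_mul
      (fun ω => Real.exp (-∑ i, (if p i then (m i : ℝ) else 0) * gammaVector Y i ω))
      (fun ω => Real.exp (-∑ i, (if p i then 0 else (m i : ℝ)) * gammaVector Y i ω)),
    integral_exp_neg_sum_mul_gammaVector hC hY hlaw hind fun i => by split_ifs <;> simp,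
    integral_exp_neg_sum_mul_gammaVector hC hY hlaw hind fun i => by split_ifs <;> simp,
    det_one_add_diagonal_mul_crossScale_zero, Real.sqrt_mul, mul_inv, mul_pow]
  exact zero_le_one.trans (hC.one_le_det_one_add_diagonal_mul fun i => by split_ifs <;> simp)

/-- Correlation inequality for a nonnegative nondecreasing polynomial of `exp (-Γ i)`. -/
lemma integral_prod_eval_mul_le (p : Fin n → Prop) [DecidablePred p]
    (hC : C.PosSemidef) (hY : ∀ m, AEMeasurable (Y m) P)
    (hlaw : ∀ m, HasLaw (fun ω => toLp 2 (Y m ω)) (multivariateGaussian 0 C) P)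
    (hind : iIndepFun Y P) {q : ℝ[X]} (hq : ∀ u ∈ Set.Icc (0 : ℝ) 1, 0 ≤ q.eval u)
    (hq' : ∀ u ∈ Set.Icc (0 : ℝ) 1, 0 ≤ (derivative q).eval u) :
    (∫ ω, ∏ i with p i, q.eval (Real.exp (-gammaVector Y i ω)) ∂P) *
        ∫ ω, ∏ i with ¬p i, q.eval (Real.exp (-gammaVector Y i ω)) ∂P ≤
      ∫ ω, ∏ i, q.eval (Real.exp (-gammaVector Y i ω)) ∂P := by
  rw [← interpolation_zero hC hY hlaw hind, ← interpolation_one (p := p) hC hY hlaw hind]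
  exact monotoneOn_interpolation hC k hq hq' (by simp) (by simp) zero_le_one

end Interpolation

/-! ### Monotone polynomial approximation of a step -/

section StepPolynomial

open Polynomial Filter Topology

/-- A nondecreasing polynomial on `[0, 1]` which approximates the indicator of `[c, 1]`. -/
noncomputable def stepPolynomial (c : ℝ) (a : ℕ) : ℝ[X] := 1 - (1 - X ^ a) ^ ⌈(a : ℝ) / c ^ a⌉₊

variable {c : ℝ} {a : ℕ} {u : ℝ}

lemma eval_stepPolynomial :
    (stepPolynomial c a).eval u = 1 - (1 - u ^ a) ^ ⌈(a : ℝ) / c ^ a⌉₊ := by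
  simp [stepPolynomial]

lemma eval_stepPolynomial_mem (hu : u ∈ Set.Icc (0 : ℝ) 1) :
    (stepPolynomial c a).eval u ∈ Set.Icc (0 : ℝ) 1 := by
  have h0 : 0 ≤ 1 - u ^ a := sub_nonneg.2 (pow_le_one₀ hu.1 hu.2)
  have h1 : 1 - u ^ a ≤ 1 := sub_le_self _ (pow_nonneg hu.1 _)
  rw [eval_stepPolynomial]
  exact ⟨sub_nonneg.2 (pow_le_one₀ h0 h1), sub_le_self _ (pow_nonneg h0 _)⟩

lemma eval_derivative_stepPolynomial_nonneg (hu : u ∈ Set.Icc (0 : ℝ) 1) :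
    0 ≤ (derivative (stepPolynomial c a)).eval u := by
  have h0 : 0 ≤ 1 - u ^ a := sub_nonneg.2 (pow_le_one₀ hu.1 hu.2)
  have h1 := hu.1
  simp only [stepPolynomial, derivative_sub, derivative_one, derivative_pow, derivative_X,
    eval_sub, eval_mul, eval_pow, eval_X, eval_one, eval_C, zero_sub,
    mul_neg, neg_neg, mul_one]
  positivity

/-- With `N = ⌈a / c ^ a⌉₊`, the product `N * u ^ a` is at least `a` when `c ≤ u`, and at most `a *
(u / c) ^ a + u ^ a → 0` when `u < c`. The first case uses `1 - x ≤ exp (-x)`, the second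
Bernoulli's inequality. The limit at `u = c` is `1`, matching the closed event. -/
lemma tendsto_eval_stepPolynomial (hc : 0 < c) (hc1 : c ≤ 1) (hu : u ∈ Set.Icc (0 : ℝ) 1) :
    Tendsto (fun a => (stepPolynomial c a).eval u) atTop (𝓝 (if c ≤ u then 1 else 0)) := by
  have h0 : ∀ a : ℕ, 0 ≤ 1 - u ^ a := fun a => sub_nonneg.2 (pow_le_one₀ hu.1 hu.2)
  split_ifs with h
  · have hlim : Tendsto (fun a : ℕ => 1 - Real.exp (-(a : ℝ))) atTop (𝓝 1) := by
      simpa using (Real.tendsto_exp_neg_atTop_nhds_zero.comp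
        (tendsto_natCast_atTop_atTop (R := ℝ))).const_sub 1
    refine tendsto_of_tendsto_of_tendsto_of_le_of_le hlim tendsto_const_nhds (fun a => ?_)
      fun a => (eval_stepPolynomial_mem hu).2
    simp only
    rw [eval_stepPolynomial]
    refine sub_le_sub_left ?_ _
    calc (1 - u ^ a) ^ ⌈(a : ℝ) / c ^ a⌉₊ ≤ Real.exp (-(u ^ a)) ^ ⌈(a : ℝ) / c ^ a⌉₊ :=
          pow_le_pow_left₀ (h0 a) (Real.one_sub_le_exp_neg _) _
      _ = Real.exp (-(⌈(a : ℝ) / c ^ a⌉₊ * u ^ a)) := by rw [← Real.exp_nat_mul, mul_neg]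
      _ ≤ Real.exp (-(a : ℝ)) := by
          rw [Real.exp_le_exp, neg_le_neg_iff]
          calc (a : ℝ) = (a : ℝ) / c ^ a * c ^ a := by field_simp
            _ ≤ _ := mul_le_mul (Nat.le_ceil _) (pow_le_pow_left₀ hc.le h _) (by positivity)
              (Nat.cast_nonneg _)
  · rw [not_le] at h
    have hr0 : 0 ≤ u / c := div_nonneg hu.1 hc.le
    have hr1 : u / c < 1 := (div_lt_one hc).2 h
    have hb : ∀ a : ℕ, u ^ a ≤ (1 : ℝ) := fun a => pow_le_one₀ hu.1 hu.2
    have hlim1 := tendsto_self_mul_const_pow_of_lt_one hr0 hr1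
    have h1 : u < 1 := h.trans_le hc1
    have hlim : Tendsto (fun a : ℕ => (a : ℝ) * (u / c) ^ a + u ^ a) atTop (𝓝 0) := by
      simpa using hlim1.add (tendsto_pow_atTop_nhds_zero_of_lt_one hu.1 h1)
    refine tendsto_of_tendsto_of_tendsto_of_le_of_le tendsto_const_nhds hlim
      (fun a => (eval_stepPolynomial_mem hu).1) fun a => ?_
    simp only
    rw [eval_stepPolynomial]
    have hbern := one_add_mul_le_pow (a := -u ^ a) (by linarith [hb a]) ⌈(a : ℝ) / c ^ a⌉₊
    have hceil := mul_le_mul_of_nonneg_right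
      (Nat.ceil_lt_add_one (a := (a : ℝ) / c ^ a) (by positivity)).le (pow_nonneg hu.1 a)
    rw [div_pow]
    have : (a : ℝ) * (u ^ a / c ^ a) + u ^ a = ((a : ℝ) / c ^ a + 1) * u ^ a := by ring
    rw [this, sub_eq_add_neg 1 (u ^ a)]
    linarith

end StepPolynomial

/-! ### Passage from polynomials to probabilities -/

section Limit

open Filter Topology Polynomial

variable {Ω : Type*} [MeasurableSpace Ω] {P : Measure Ω} [IsProbabilityMeasure P] {n : ℕ}

omit [IsProbabilityMeasure P] in
lemma nullMeasurableSet_maxLEEvent {Γ : Fin n → Ω → ℝ} (hΓ : ∀ i, AEMeasurable (Γ i) P)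
    (J : Set (Fin n)) (r : ℝ) : NullMeasurableSet (maxLEEvent Γ J r) P := by
  have : maxLEEvent Γ J r = ⋂ i ∈ J, {ω | Γ i ω ≤ r} := by
    ext ω; simp [maxLEEvent]
  rw [this]
  exact NullMeasurableSet.biInter J.to_countable fun i _ =>
    nullMeasurableSet_le (hΓ i) aemeasurable_const

/-- Dominated convergence with bound `1`. Convergence holds at every `ω`, including those with `Γ i
ω = r`, so atoms of the law are harmless. -/
lemma tendsto_integral_prod_stepPolynomial {Γ : Fin n → Ω → ℝ} (hΓ : ∀ i, AEMeasurable (Γ i) P)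
    (hnn : ∀ i ω, 0 ≤ Γ i ω) (J : Finset (Fin n)) {r : ℝ} (hr : 0 ≤ r) :
    Tendsto (fun a => ∫ ω, ∏ i ∈ J,
        (stepPolynomial (Real.exp (-r)) a).eval (Real.exp (-Γ i ω)) ∂P) atTop
      (𝓝 (P.real (maxLEEvent Γ J r))) := by
  have hu : ∀ i ω, Real.exp (-Γ i ω) ∈ Set.Icc (0 : ℝ) 1 := fun i ω =>
    ⟨(Real.exp_pos _).le, Real.exp_le_one_iff.2 (neg_nonpos.2 (hnn i ω))⟩
  have hind : P.real (maxLEEvent Γ J r) =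
      ∫ ω, ∏ i ∈ J, (if Real.exp (-r) ≤ Real.exp (-Γ i ω) then (1 : ℝ) else 0) ∂P := by
    have : ∀ ω, ∏ i ∈ J, (if Real.exp (-r) ≤ Real.exp (-Γ i ω) then (1 : ℝ) else 0) =
        (maxLEEvent Γ J r).indicator (fun _ => 1) ω := by
      intro ω
      classical
      rw [Finset.prod_ite_zero, Finset.prod_const_one, Set.indicator_apply]
      simp [maxLEEvent]
    simp_rw [this]
    rw [integral_indicator₀ (nullMeasurableSet_maxLEEvent hΓ _ _)]
    simp [measureReal_def]
  rw [hind]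
  refine tendsto_integral_of_dominated_convergence (fun _ => 1) (fun a => ?_)
    (integrable_const _) (fun a => ae_of_all _ fun ω => ?_) (ae_of_all _ fun ω => ?_)
  · refine (Finset.aemeasurable_fun_prod _ fun i _ => ?_).aestronglyMeasurable
    exact (Polynomial.continuous _).measurable.comp_aemeasurable
      (Real.measurable_exp.comp_aemeasurable (hΓ i).neg)
  · rw [Real.norm_of_nonneg (Finset.prod_nonneg fun i _ => (eval_stepPolynomial_mem (hu i ω)).1)]
    exact Finset.prod_le_one (fun i _ => (eval_stepPolynomial_mem (hu i ω)).1)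
      fun i _ => (eval_stepPolynomial_mem (hu i ω)).2
  · exact tendsto_finsetProd _ fun i _ => tendsto_eval_stepPolynomial (Real.exp_pos _)
      (Real.exp_le_one_iff.2 (neg_nonpos.2 hr)) (hu i ω)

end Limit

theorem mainTheorem2 {Ω₀ Ω : Type*} [MeasurableSpace Ω₀] [MeasurableSpace Ω]
    (P₀ : Measure Ω₀) [IsProbabilityMeasure P₀] (P : Measure Ω) [IsProbabilityMeasure P]
    (n n₁ k : ℕ) (hn₁ : 1 ≤ n₁) (hn : n₁ ≤ n) (hk : 1 ≤ k)
    -- the Gaussian vector, and `k` independent copies of it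
    (X₀ : Ω₀ → (Fin n → ℝ)) (hX₀ : IsCenteredGaussianVector X₀ P₀)
    (X : Fin k → Ω → (Fin n → ℝ)) (hcopy : ∀ m, IdentDistrib (X m) X₀ P P₀)
    (hindep : iIndepFun X P) :
    P.real (maxLEEvent (gammaVector X) Set.univ (1 / 2)) ≥
      P.real (maxLEEvent (gammaVector X) {i | (i : ℕ) < n₁} (1 / 2)) *
        P.real (maxLEEvent (gammaVector X) {i | n₁ ≤ (i : ℕ)} (1 / 2)) := by
  obtain ⟨C, hC, hlaw₀⟩ := hX₀.exists_hasLaw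
  have hX : ∀ m, AEMeasurable (X m) P := fun m => (hcopy m).aemeasurable_fst
  have hlaw : ∀ m, HasLaw (fun ω => WithLp.toLp 2 (X m ω)) (multivariateGaussian 0 C) P := by
    intro m
    have hid := (hcopy m).comp (u := WithLp.toLp 2) (by fun_prop)
    exact ⟨hid.aemeasurable_fst, hid.map_eq.trans hlaw₀.map_eq⟩
  have hlim := fun J : Finset (Fin n) => tendsto_integral_prod_stepPolynomial
    (aemeasurable_gammaVector hX) gammaVector_nonneg J (one_half_pos (α := ℝ)).le
  have h := le_of_tendsto_of_tendsto'
    ((hlim {i | (i : ℕ) < n₁}).mul (hlim {i | ¬(i : ℕ) < n₁})) (hlim Finset.univ) fun a =>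
      integral_prod_eval_mul_le (fun i : Fin n => (i : ℕ) < n₁) hC hX hlaw hindep
        (fun u hu => (eval_stepPolynomial_mem hu).1)
        fun u hu => eval_derivative_stepPolynomial_nonneg hu
  simpa using h
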